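/- Let $\mathbb G$ be a connected undirected graph without self-loops on the agents $1,\dots,m$, and let $\mathcal N_i$ be the set of neighbors of $i$. Let $A_i\in\mathbb R^{n_i\times n}$ for $i=1,\dots,m$ be such that the stacked matrix $A=\mathrm{col}\{A_1,\dots,A_m\}$ has full row rank, and let $P_i$ be the orthogonal projection of $\mathbb R^n$ onto $\ker A_i$. For $f:\mathbb R^n\to\mathbb R^n$ let $F[f](x)=\bigcap_{\varepsilon>0}\bigcap_{\mu(S)=0}\overline{\mathrm{co}}\,\{f(B(x,\varepsilon)\setminus S)\}$ be the Filippov set-valued map ($\mu$ is Lebesgue measure), and let $\mathrm{sgn}$ be the entrywise sign function (with $\mathrm{sgn}\,0=0$), so that the $l$-th entry of an element of $F[\mathrm{sgn}](x)$ is $1$ if $x_l>0$, $-1$ if $x_l<0$, and any number in $[-1,1]$ if $x_l=0$. There is a constant $\delta_0>0$, depending only on $\mathbb G$ and $A_1,\dots,A_m$, such that the following holds for all $b_i\in\mathbb R^{n_i}$, with $b=\mathrm{col}\{b_1,\dots,b_m\}$, and all $0\le\delta<\delta_0$. Let $k:[0,\infty)\to\mathbb R$ be measurable, essentially bounded on every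 bounded interval, and nonnegative for all sufficiently large $t$, with $\lim_{t\to\infty}k(t)=\delta$ and $\int_0^\infty k(t)\,dt=\infty$. Let $y_1,\dots,y_m:[0,\infty)\to\mathbb R^n$ be absolutely continuous on every bounded interval, with $A_iy_i(0)=b_i$ for all $i$, and suppose that for almost every $t\ge 0$ $$\dot y_i=-k(t)P_i\phi_i-P_i\sum_{j\in\mathcal N_i}\phi_{ij},\qquad i=1,\dots,m,$$ for some $\phi_i\in F[\mathrm{sgn}](y_i)$ and $\phi_{ij}\in F[\mathrm{sgn}](y_i-y_j)$ (depending on $t$) with $\phi_{ij}=-\phi_{ji}$ whenever $i$ and $j$ are neighbors. Then all agents reach, in finite time, a common constant value that is a minimum $l_1$-norm solution of $Ax=b$: there are $T\ge 0$ and $\bar x$ with $A\bar x=b$ and $\|\bar x\|_1\le\|x\|_1$ for every $x$ with $Ax=b$, such that $y_i(t)=\bar x$ for all $t\ge T$ and all $i$. -/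

import Mathlib

open Filter Topology MeasureTheory

noncomputable section

/-- The Filippov set-valued map `F[f]` of a map `f : ℝʳ → ℝʳ`:
`F[f](x) = ⋂_{ε > 0} ⋂_{μ(S) = 0} closure (co (f (B(x, ε) \ S)))`, `μ` being Lebesgue measure. -/
def filippovMap {r : ℕ} (f : EuclideanSpace ℝ (Fin r) → EuclideanSpace ℝ (Fin r))
    (x : EuclideanSpace ℝ (Fin r)) : Set (EuclideanSpace ℝ (Fin r)) :=
  ⋂ (ε : ℝ) (_ : 0 < ε) (S : Set (EuclideanSpace ℝ (Fin r))) (_ : volume S = 0),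
    closure (convexHull ℝ (f '' (Metric.ball x ε \ S)))

/-- The entrywise sign function on `ℝʳ`, with value `0` at entries equal to `0`. -/
def sgnVec {r : ℕ} (x : EuclideanSpace ℝ (Fin r)) : EuclideanSpace ℝ (Fin r) :=
  WithLp.toLp 2 (fun l => Real.sign (x l))

/-- The `l₁` norm of a vector in `ℝʳ`. -/
def l1Norm {r : ℕ} (x : EuclideanSpace ℝ (Fin r)) : ℝ := ∑ l, |x l|

/-- The matrix `A = col {A₁, …, A_m}`. -/
def stackMatrix {m n : ℕ} {r : Fin m → ℕ} (A : (i : Fin m) → Matrix (Fin (r i)) (Fin n) ℝ) :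
    Matrix (Σ i, Fin (r i)) (Fin n) ℝ :=
  Matrix.of fun p l => A p.1 p.2 l

/-- The vector `b = col {b₁, …, b_m}`. -/
def stackVec {m : ℕ} {r : Fin m → ℕ} (b : (i : Fin m) → Fin (r i) → ℝ) :
    (Σ i, Fin (r i)) → ℝ :=
  fun p => b p.1 p.2

/-- `x` is a minimum `l₁`-norm solution of `A x = b`. -/
def IsMinL1Solution {ι : Type} {n : ℕ} (A : Matrix ι (Fin n) ℝ) (b : ι → ℝ)
    (x : EuclideanSpace ℝ (Fin n)) : Prop :=
  A.mulVec x.ofLp = b ∧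
    ∀ w : EuclideanSpace ℝ (Fin n), A.mulVec w.ofLp = b → l1Norm x ≤ l1Norm w

/-- The orthogonal projection of `ℝⁿ` onto `ker M`. -/
def kerProj {s n : ℕ} (M : Matrix (Fin s) (Fin n) ℝ) :
    EuclideanSpace ℝ (Fin n) →L[ℝ] EuclideanSpace ℝ (Fin n) :=
  (LinearMap.ker (Matrix.toLpLin 2 2 M)).starProjection

/-- `y = (y₁, …, y_m)` is a Filippov solution on `[0, ∞)` of the distributed update
`y_i' = -k(t) P_i φ_i - P_i ∑_{j ∈ N_i} φ_ij`, `A_i y_i(0) = b_i`, where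
`φ_i ∈ F[sgn](y_i)`, `φ_ij ∈ F[sgn](y_i - y_j)` and `φ_ij = -φ_ji` for neighbors `i`, `j`. -/
structure IsDistributedL1Solution {m n : ℕ} {r : Fin m → ℕ}
    (G : SimpleGraph (Fin m)) [DecidableRel G.Adj]
    (A : (i : Fin m) → Matrix (Fin (r i)) (Fin n) ℝ) (b : (i : Fin m) → Fin (r i) → ℝ)
    (k : ℝ → ℝ) (y : Fin m → ℝ → EuclideanSpace ℝ (Fin n)) : Prop where
  init : ∀ i, (A i).mulVec (y i 0).ofLp = b i
  absCont : ∀ i, ∀ T : ℝ, 0 ≤ T → AbsolutelyContinuousOnInterval (y i) 0 T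
  update : ∀ᵐ t : ℝ, 0 ≤ t →
    ∃ (φ : Fin m → EuclideanSpace ℝ (Fin n)) (ψ : Fin m → Fin m → EuclideanSpace ℝ (Fin n)),
      (∀ i, φ i ∈ filippovMap sgnVec (y i t)) ∧
      (∀ i j, G.Adj i j → ψ i j ∈ filippovMap sgnVec (y i t - y j t) ∧ ψ i j = -ψ j i) ∧
      ∀ i, HasDerivAt (y i)
        (-(k t • kerProj (A i) (φ i)) - kerProj (A i) (∑ j ∈ G.neighborFinset i, ψ i j)) t

end

/-! ### Absolutely continuous functions -/

/-! Two Lyapunov functions are used, one after the other: the disagreement `V`, then the `l₁` norm.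
Both are convex, and at almost every time any subgradient computes their derivative along the
trajectory (`deriv_comp_eq_of_subgradient`).

Consensus. Put `g i = ∑ j, ψ i j`; the family `2 g` is a subgradient of `V`. Full row rank gives a
consensus solution within `C * V` of every `y i`, and convexity then bounds `∑ ‖P_i g_i‖²` below by
some `c > 0` whenever `V > 0` (`exists_le_sum_norm_sq_kerProj`). Completing the square gives `V' ≤
k² n m - c`, which is at most `-c/2` for small `k`, so `V` vanishes in finite time. The constant `c`
does not depend on `b`, hence neither does `δ₀`.

Optimality. After consensus, averaging over the agents and projecting onto `K = ⋂ ker A_i` cancels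
the antisymmetric coupling and leaves `x' = -k P_K φ`, with `φ` a subgradient of the `l₁` norm at
`x`. The norm decreases at rate `k ‖P_K φ‖²`. There are only finitely many subdifferentials, all
compact, so `‖P_K φ‖` is bounded below off the minimizers
(`exists_le_norm_starProjection_of_not_minimizer`). As `∫ k = ∞`, a minimizer is reached in finite
time; from then on the norm is constant, which forces `x' = 0`. -/

theorem AbsolutelyContinuousOnInterval.lipschitz_comp {X Y : Type*} [PseudoMetricSpace X]
    [PseudoMetricSpace Y] {f : ℝ → X} {g : X → Y} {K : NNReal} {a b : ℝ}
    (hf : AbsolutelyContinuousOnInterval f a b) (hg : LipschitzWith K g) :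
    AbsolutelyContinuousOnInterval (fun t => g (f t)) a b := by
  rw [absolutelyContinuousOnInterval_iff] at hf ⊢
  intro ε hε
  obtain ⟨δ, hδ, h⟩ := hf (ε / (K + 1)) (by positivity)
  refine ⟨δ, hδ, fun E hE hlt => ?_⟩
  have h1 := h E hE hlt
  calc ∑ i ∈ Finset.range E.1, dist (g (f (E.2 i).1)) (g (f (E.2 i).2))
      ≤ ∑ i ∈ Finset.range E.1, (K + 1 : ℝ) * dist (f (E.2 i).1) (f (E.2 i).2) := by
        refine Finset.sum_le_sum fun i _ => (hg.dist_le_mul _ _).trans ?_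
        gcongr
        linarith
    _ = (K + 1 : ℝ) * ∑ i ∈ Finset.range E.1, dist (f (E.2 i).1) (f (E.2 i).2) := by
        rw [Finset.mul_sum]
    _ < (K + 1 : ℝ) * (ε / (K + 1)) := by gcongr
    _ = ε := by field_simp

theorem AbsolutelyContinuousOnInterval.finset_sum {ι F : Type*} [SeminormedAddCommGroup F]
    (s : Finset ι) {f : ι → ℝ → F} {a b : ℝ}
    (hf : ∀ i ∈ s, AbsolutelyContinuousOnInterval (f i) a b) :
    AbsolutelyContinuousOnInterval (fun t => ∑ i ∈ s, f i t) a b := by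
  classical
  induction s using Finset.induction_on with
  | empty =>
    simpa using (LipschitzWith.const (0 : F)).lipschitzOnWith.absolutelyContinuousOnInterval
  | insert i s hi ih =>
    simp only [Finset.sum_insert hi]
    exact (hf i (by simp)).fun_add (ih fun j hj => hf j (by simp [hj]))

theorem AbsolutelyContinuousOnInterval.l1Norm_comp {n : ℕ} {x : ℝ → EuclideanSpace ℝ (Fin n)}
    {a b : ℝ} (hx : AbsolutelyContinuousOnInterval x a b) :
    AbsolutelyContinuousOnInterval (fun t => l1Norm (x t)) a b := by
  have hl : ∀ l : Fin n, LipschitzWith 1 fun z : EuclideanSpace ℝ (Fin n) => |z l| := by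
    refine fun l => LipschitzWith.of_dist_le_mul fun z w => ?_
    rw [Real.dist_eq, dist_eq_norm, NNReal.coe_one, one_mul]
    exact (abs_abs_sub_abs_le_abs_sub _ _).trans (PiLp.norm_apply_le (z - w) l)
  simp only [l1Norm]
  exact AbsolutelyContinuousOnInterval.finset_sum Finset.univ fun l _ => hx.lipschitz_comp (hl l)

theorem AbsolutelyContinuousOnInterval.sub_le_integral {f g : ℝ → ℝ} {a b : ℝ} (hab : a ≤ b)
    (hf : AbsolutelyContinuousOnInterval f a b) (hg : IntervalIntegrable g volume a b)
    (h : ∀ᵐ t, t ∈ Set.Icc a b → deriv f t ≤ g t) : f b - f a ≤ ∫ t in a..b, g t := by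
  rw [← hf.integral_deriv_eq_sub]
  exact intervalIntegral.integral_mono_ae_restrict hab hf.intervalIntegrable_deriv hg
    ((ae_restrict_iff' measurableSet_Icc).2 h)

theorem antitoneOn_of_ae_deriv_nonpos {f : ℝ → ℝ} {a : ℝ}
    (hf : ∀ T, a ≤ T → AbsolutelyContinuousOnInterval f a T)
    (h : ∀ᵐ t, a ≤ t → deriv f t ≤ 0) : AntitoneOn f (Set.Ici a) := by
  intro s hs t ht hst
  have hst' : AbsolutelyContinuousOnInterval f s t :=
    (hf t ht).mono (by
      rw [Set.uIcc_of_le hst, Set.uIcc_of_le (show a ≤ t from ht)]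
      exact Set.Icc_subset_Icc_left hs)
  have := hst'.sub_le_integral hst (g := fun _ => 0) (by simp)
    (h.mono fun u hu hu' => hu ((show a ≤ s from hs).trans hu'.1))
  simp at this
  linarith

theorem ae_differentiableAt_of_forall_absolutelyContinuous {f : ℝ → ℝ} {a : ℝ}
    (hf : ∀ T, a ≤ T → AbsolutelyContinuousOnInterval f a T) :
    ∀ᵐ t, a ≤ t → DifferentiableAt ℝ f t := by
  have h1 : ∀ N : ℕ, ∀ᵐ t, t ∈ Set.uIcc a (a + N) → DifferentiableAt ℝ f t :=
    fun N => (hf (a + N) (by simp)).ae_differentiableAt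
  filter_upwards [ae_all_iff.2 h1] with t ht hat
  obtain ⟨N, hN⟩ := exists_nat_ge (t - a)
  refine ht N ?_
  rw [Set.uIcc_of_le (by simp)]
  exact ⟨hat, by linarith⟩

/-- Along a differentiable curve, the derivative of a function is given by any subgradient. -/
theorem deriv_comp_eq_of_subgradient {E : Type*} [NormedAddCommGroup E] [NormedSpace ℝ E]
    {f : E → ℝ} {y : ℝ → E} {v : E} {t : ℝ} (L : E →L[ℝ] ℝ)
    (hL : ∀ z, f (y t) + L (z - y t) ≤ f z) (hy : HasDerivAt y v t)
    (hf : DifferentiableAt ℝ (fun s => f (y s)) t) : deriv (fun s => f (y s)) t = L v := by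
  have h1 : HasDerivAt (fun s => f (y s) - L (y s)) (deriv (fun s => f (y s)) t - L v) t :=
    hf.hasDerivAt.sub (L.hasFDerivAt.comp_hasDerivAt t hy)
  -- The subgradient inequality says that `f - L` along the curve is minimal at time `t`.
  have h2 : IsLocalMin (fun s => f (y s) - L (y s)) t := by
    refine Eventually.of_forall fun s => ?_
    have := hL (y s)
    rw [map_sub] at this
    simp only
    linarith
  linarith [h2.hasDerivAt_eq_zero h1]

/-- A nonnegative function that decreases at a positive rate while positive vanishes from some
time on. -/
theorem eventually_eq_zero_of_deriv_le {f : ℝ → ℝ} {a c : ℝ} (hc : 0 < c)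
    (hf : ∀ T, a ≤ T → AbsolutelyContinuousOnInterval f a T) (hf0 : ∀ t, 0 ≤ f t)
    (h : ∀ᵐ t, a ≤ t → 0 < f t → deriv f t ≤ -c) : ∃ T, a ≤ T ∧ ∀ t, T ≤ t → f t = 0 := by
  have hex : ∃ T, a ≤ T ∧ f T = 0 := by
    by_contra! hne
    have hpos : ∀ t, a ≤ t → 0 < f t := fun t ht => (hf0 t).lt_of_ne (hne t ht).symm
    -- After this much time at rate `c`, the value would be at most `-1`.
    have hT : a ≤ a + (f a + 1) / c := by
      have := hf0 a
      have : 0 ≤ (f a + 1) / c := by positivity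
      linarith
    have h1 := (hf _ hT).sub_le_integral hT (g := fun _ => -c) (by simp)
      (h.mono fun t ht ht' => ht ht'.1 (hpos t ht'.1))
    have h2 : (f a + 1) / c * c = f a + 1 := by field_simp
    simp only [intervalIntegral.integral_const, smul_eq_mul] at h1
    have := hf0 (a + (f a + 1) / c)
    nlinarith
  obtain ⟨T, hT, hfT⟩ := hex
  refine ⟨T, hT, fun t ht => le_antisymm ?_ (hf0 t)⟩
  rw [← hfT]
  refine antitoneOn_of_ae_deriv_nonpos hf (h.mono fun s hs has => ?_) hT (hT.trans ht) ht
  rcases (hf0 s).lt_or_eq with hpos | hz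
  · linarith [hs has hpos]
  -- The rate hypothesis is silent where `f = 0`, but there `f` has a global minimum.
  · have : IsLocalMin f s := Eventually.of_forall fun u => hz ▸ hf0 u
    exact this.deriv_eq_zero.le

/-! ### The Filippov map of the sign function and the `l₁` norm -/

/-- `φ` is a subgradient of the `l₁` norm at `x`. -/
def IsSignSelection {n : ℕ} (φ x : EuclideanSpace ℝ (Fin n)) : Prop :=
  (∀ l, |φ l| ≤ 1) ∧ ∀ l, φ l * x l = |x l|

theorem filippovMap_subset_of_ball {n : ℕ} {f : EuclideanSpace ℝ (Fin n) → EuclideanSpace ℝ (Fin n)}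
    {x : EuclideanSpace ℝ (Fin n)} {ε : ℝ} (hε : 0 < ε) {C : Set (EuclideanSpace ℝ (Fin n))}
    (hC : IsClosed C) (hconv : Convex ℝ C) (h : ∀ z ∈ Metric.ball x ε, f z ∈ C) :
    filippovMap f x ⊆ C := by
  intro φ hφ
  simp only [filippovMap, Set.mem_iInter] at hφ
  refine closure_minimal (convexHull_min ?_ hconv) hC (hφ ε hε ∅ measure_empty)
  rintro _ ⟨z, hz, rfl⟩
  exact h z hz.1

/-- If `x l ≠ 0`, the sign of coordinate `l` is constant on the ball of radius `|x l|`, which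
confines the Filippov set to a hyperplane. Only this inclusion is needed, and the null set `∅`
suffices for it. -/
theorem isSignSelection_of_mem_filippovMap {n : ℕ} {φ x : EuclideanSpace ℝ (Fin n)}
    (h : φ ∈ filippovMap sgnVec x) : IsSignSelection φ x := by
  have hcont : ∀ l, Continuous fun z : EuclideanSpace ℝ (Fin n) => z l := fun l => by fun_prop
  have hlin : ∀ l, IsLinearMap ℝ fun z : EuclideanSpace ℝ (Fin n) => z l := fun l =>
    ⟨fun _ _ => rfl, fun _ _ => rfl⟩
  have hcoord : ∀ {l : Fin n} {z : EuclideanSpace ℝ (Fin n)}, z ∈ Metric.ball x |x l| →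
      |z l - x l| < |x l| := by
    intro l z hz
    rw [Metric.mem_ball, dist_eq_norm] at hz
    exact (PiLp.norm_apply_le (z - x) l).trans_lt hz
  refine ⟨fun l => abs_le.2 ⟨?_, ?_⟩, fun l => ?_⟩
  · refine filippovMap_subset_of_ball one_pos (C := {z | -1 ≤ z l})
      (isClosed_le continuous_const (hcont l)) (convex_halfSpace_ge (hlin l) _) ?_ h
    intro z _
    rcases Real.sign_apply_eq (z l) with h | h | h <;> simp [sgnVec, h]
  · refine filippovMap_subset_of_ball one_pos (C := {z | z l ≤ 1})
      (isClosed_le (hcont l) continuous_const) (convex_halfSpace_le (hlin l) _) ?_ h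
    intro z _
    rcases Real.sign_apply_eq (z l) with h | h | h <;> simp [sgnVec, h]
  · rcases lt_trichotomy (x l) 0 with hx | hx | hx
    · have : φ ∈ {z : EuclideanSpace ℝ (Fin n) | z l = -1} := by
        refine filippovMap_subset_of_ball (abs_pos.2 hx.ne)
          (isClosed_eq (hcont l) continuous_const) (convex_hyperplane (hlin l) _) ?_ h
        intro z hz
        have h1 := hcoord hz
        rw [abs_of_neg hx, abs_lt] at h1
        exact Real.sign_of_neg (by linarith)
      rw [show φ l = -1 from this, abs_of_neg hx]
      ring
    · simp [hx]
    · have : φ ∈ {z : EuclideanSpace ℝ (Fin n) | z l = 1} := by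
        refine filippovMap_subset_of_ball (abs_pos.2 hx.ne')
          (isClosed_eq (hcont l) continuous_const) (convex_hyperplane (hlin l) _) ?_ h
        intro z hz
        have h1 := hcoord hz
        rw [abs_of_pos hx, abs_lt] at h1
        exact Real.sign_of_pos (by linarith)
      rw [show φ l = 1 from this, abs_of_pos hx]
      ring

theorem IsSignSelection.l1Norm_add_inner_le {n : ℕ} {φ x : EuclideanSpace ℝ (Fin n)}
    (h : IsSignSelection φ x) (z : EuclideanSpace ℝ (Fin n)) :
    l1Norm x + inner ℝ φ (z - x) ≤ l1Norm z := by
  rw [l1Norm, l1Norm, PiLp.inner_apply, ← Finset.sum_add_distrib]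
  refine Finset.sum_le_sum fun l _ => ?_
  have h1 := h.1 l
  have h2 := h.2 l
  have h3 : φ l * z l ≤ |z l| := by
    calc φ l * z l ≤ |φ l| * |z l| := by rw [← abs_mul]; exact le_abs_self _
      _ ≤ 1 * |z l| := by gcongr
      _ = |z l| := one_mul _
  simp only [PiLp.sub_apply, RCLike.inner_apply, conj_trivial]
  linarith

theorem IsSignSelection.norm_sq_le {n : ℕ} {φ x : EuclideanSpace ℝ (Fin n)}
    (h : IsSignSelection φ x) : ‖φ‖ ^ 2 ≤ n := by
  rw [EuclideanSpace.norm_sq_eq]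
  calc ∑ l, ‖φ l‖ ^ 2 ≤ ∑ _l : Fin n, (1 : ℝ) :=
        Finset.sum_le_sum fun l _ => pow_le_one₀ (norm_nonneg _) (h.1 l)
    _ = n := by simp

theorem l1Norm_nonneg {n : ℕ} (x : EuclideanSpace ℝ (Fin n)) : 0 ≤ l1Norm x :=
  Finset.sum_nonneg fun _ _ => abs_nonneg _

theorem norm_le_l1Norm {n : ℕ} (x : EuclideanSpace ℝ (Fin n)) : ‖x‖ ≤ l1Norm x := by
  refine abs_le_of_sq_le_sq' ?_ (l1Norm_nonneg x) |>.2
  rw [EuclideanSpace.norm_sq_eq, l1Norm]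
  simpa using Finset.sum_sq_le_sq_sum_of_nonneg (s := Finset.univ) (f := fun l => |x l|)
    fun _ _ => abs_nonneg _

/-! ### Sharpness of the `l₁` norm on affine subspaces -/

/-- First-order optimality: for `φ` orthogonal to `K`, the linear term of the subgradient inequality
vanishes on `x + K`. -/
theorem IsSignSelection.l1Norm_le_of_starProjection_eq_zero {n : ℕ}
    {K : Submodule ℝ (EuclideanSpace ℝ (Fin n))} {φ x z : EuclideanSpace ℝ (Fin n)}
    (h : IsSignSelection φ x) (hφ : K.starProjection φ = 0) (hz : z - x ∈ K) :
    l1Norm x ≤ l1Norm z := by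
  have h1 := h.l1Norm_add_inner_le z
  rw [← Submodule.starProjection_eq_self_iff.2 hz, ← Submodule.inner_starProjection_left_eq_right,
    hφ, inner_zero_left] at h1
  linarith

/-- The projections onto `K` of the subgradients of the `l₁` norm at points that do not minimize
it over their coset of `K` are bounded away from `0`. -/
theorem exists_le_norm_starProjection_of_not_minimizer {n : ℕ}
    (K : Submodule ℝ (EuclideanSpace ℝ (Fin n))) :
    ∃ c : ℝ, 0 < c ∧ ∀ φ x : EuclideanSpace ℝ (Fin n), IsSignSelection φ x →
      (¬ ∀ z, z - x ∈ K → l1Norm x ≤ l1Norm z) → c ≤ ‖K.starProjection φ‖ := by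
  -- For `σ` the sign pattern of `x`, `C σ` is the subdifferential of the `l₁` norm at `x`.
  let C : (Fin n → ℝ) → Set (EuclideanSpace ℝ (Fin n)) := fun σ =>
    {φ | ∀ l, |φ l| ≤ 1 ∧ (σ l ≠ 0 → φ l = σ l)}
  have hcomp : ∀ σ, IsCompact (C σ) := by
    intro σ
    refine Metric.isCompact_of_isClosed_isBounded ?_ ?_
    · simp only [C, Set.ofPred_forall, Set.ofPred_and]
      refine isClosed_iInter fun l => IsClosed.inter ?_ (isClosed_iInter fun _ => ?_)
      · exact isClosed_le (by fun_prop) continuous_const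
      · exact isClosed_eq (by fun_prop) continuous_const
    · refine (Metric.isBounded_closedBall (x := 0) (r := (n : ℝ))).subset fun φ hφ => ?_
      rw [mem_closedBall_zero_iff]
      refine (norm_le_l1Norm φ).trans ?_
      calc l1Norm φ ≤ ∑ _l : Fin n, (1 : ℝ) := Finset.sum_le_sum fun l _ => (hφ l).1
        _ = n := by simp
  have key : ∀ σ : Fin n → SignType, ∃ c : ℝ, 0 < c ∧
      ((∀ φ ∈ C (fun l => (σ l : ℝ)), c ≤ ‖K.starProjection φ‖) ∨
        ∃ φ ∈ C (fun l => (σ l : ℝ)), K.starProjection φ = 0) := by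
    intro σ
    by_cases hne : (C fun l => (σ l : ℝ)).Nonempty
    · obtain ⟨φ₀, hφ₀, hmin⟩ := (hcomp _).exists_isMinOn hne
        (f := fun φ => ‖K.starProjection φ‖) (by fun_prop)
      by_cases h0 : K.starProjection φ₀ = 0
      -- The value `1` is a filler: this alternative will make `x` a minimizer, so no bound is
      -- needed.
      · exact ⟨1, one_pos, Or.inr ⟨φ₀, hφ₀, h0⟩⟩
      · exact ⟨_, norm_pos_iff.2 h0, Or.inl fun φ hφ => hmin hφ⟩
    · exact ⟨1, one_pos, Or.inl fun φ hφ => (hne ⟨φ, hφ⟩).elim⟩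
  choose c hc hcσ using key
  obtain ⟨σ₀, hσ₀⟩ := Finite.exists_min c
  refine ⟨c σ₀, hc σ₀, fun φ x hφ hx => ?_⟩
  have hsel : ∀ φ', IsSignSelection φ' x ↔ φ' ∈ C fun l => (SignType.sign (x l) : ℝ) := by
    intro φ'
    simp only [IsSignSelection, C, Set.mem_ofPred_eq, ← forall_and]
    refine forall_congr' fun l => and_congr_right fun _ => ?_
    rcases lt_trichotomy (x l) 0 with h | h | h
    · simp only [sign_neg h, abs_of_neg h]
      constructor
      · intro h1 _
        have : (φ' l + 1) * x l = 0 := by linarith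
        rcases mul_eq_zero.1 this with h2 | h2
        · simp only [SignType.coe_neg_one]
          linarith
        · exact absurd h2 h.ne
      · intro h1
        rw [h1 (by simp)]
        simp
    · simp [h]
    · simp only [sign_pos h, abs_of_pos h]
      constructor
      · intro h1 _
        have : (φ' l - 1) * x l = 0 := by linarith
        rcases mul_eq_zero.1 this with h2 | h2
        · simp only [SignType.coe_one]
          linarith
        · exact absurd h2 h.ne'
      · intro h1
        rw [h1 (by simp)]
        simp
  rcases hcσ fun l => SignType.sign (x l) with h | ⟨φ', hφ', h0⟩
  · exact (hσ₀ _).trans (h φ ((hsel φ).1 hφ))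
  · exact absurd (fun z hz => ((hsel φ').2 hφ').l1Norm_le_of_starProjection_eq_zero h0 hz) hx

/-- A solution of the projected `l₁` subgradient flow with nonnegative gain of infinite integral
is eventually constant, at a minimizer. -/
theorem eventually_const_minimizer_of_projected_flow {n : ℕ}
    (K : Submodule ℝ (EuclideanSpace ℝ (Fin n))) {x : ℝ → EuclideanSpace ℝ (Fin n)} {k : ℝ → ℝ}
    {a : ℝ} (hx : ∀ T, a ≤ T → AbsolutelyContinuousOnInterval x a T)
    (hxK : ∀ t, a ≤ t → x t - x a ∈ K)
    (hk : ∀ T, a ≤ T → IntervalIntegrable k volume a T) (hk0 : ∀ t, a ≤ t → 0 ≤ k t)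
    (hkint : Tendsto (fun T => ∫ t in a..T, k t) atTop atTop)
    (hflow : ∀ᵐ t, a ≤ t → ∃ φ, IsSignSelection φ (x t) ∧
      HasDerivAt x (-(k t • K.starProjection φ)) t) :
    ∃ T, a ≤ T ∧ (∀ t, T ≤ t → x t = x T) ∧ ∀ z, z - x a ∈ K → l1Norm (x T) ≤ l1Norm z := by
  obtain ⟨c, hc, hsharp⟩ := exists_le_norm_starProjection_of_not_minimizer K
  have hW : ∀ T, a ≤ T → AbsolutelyContinuousOnInterval (fun t => l1Norm (x t)) a T :=
    fun T hT => (hx T hT).l1Norm_comp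
  have hderiv : ∀ᵐ t, a ≤ t → ∃ φ, IsSignSelection φ (x t) ∧
      HasDerivAt x (-(k t • K.starProjection φ)) t ∧
      deriv (fun t => l1Norm (x t)) t = -(k t * ‖K.starProjection φ‖ ^ 2) := by
    filter_upwards [hflow, ae_differentiableAt_of_forall_absolutelyContinuous hW] with t ht hd hat
    obtain ⟨φ, hφ, hxt⟩ := ht hat
    refine ⟨φ, hφ, hxt, ?_⟩
    rw [deriv_comp_eq_of_subgradient (innerSL ℝ φ)
      (fun z => by simpa using hφ.l1Norm_add_inner_le z) hxt (hd hat)]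
    simp only [innerSL_apply_apply, inner_neg_right, inner_smul_right]
    rw [← real_inner_self_eq_norm_sq, Submodule.inner_starProjection_left_eq_right,
      Submodule.starProjection_eq_self_iff.2 (K.starProjection_apply_mem φ)]
  -- If no minimizer were ever met, the norm would drop by at least `c² ∫ k`, which is unbounded.
  have hexT : ∃ T, a ≤ T ∧ ∀ z, z - x T ∈ K → l1Norm (x T) ≤ l1Norm z := by
    by_contra! hne
    have hbound : ∀ T, a ≤ T → c ^ 2 * ∫ t in a..T, k t ≤ l1Norm (x a) := by
      intro T hT
      have h1 := (hW T hT).sub_le_integral hT (g := fun t => -c ^ 2 * k t)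
        ((hk T hT).const_mul _) (by
          filter_upwards [hderiv] with t ht hat
          obtain ⟨φ, hφ, -, hd⟩ := ht hat.1
          have h2 := hsharp φ (x t) hφ (by
            obtain ⟨z, hz, hlt⟩ := hne t hat.1
            exact fun hmin => absurd (hmin z hz) hlt.not_ge)
          have h3 : c ^ 2 ≤ ‖K.starProjection φ‖ ^ 2 := by gcongr
          rw [hd]
          nlinarith [hk0 t hat.1])
      rw [intervalIntegral.integral_const_mul] at h1
      linarith [l1Norm_nonneg (x T)]
    obtain ⟨T, hT, hTa⟩ := ((hkint.eventually_gt_atTop (l1Norm (x a) / c ^ 2)).and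
      (eventually_ge_atTop a)).exists
    rw [div_lt_iff₀ (by positivity)] at hT
    linarith [hbound T hTa]
  obtain ⟨T, hT, hmin⟩ := hexT
  have hanti : AntitoneOn (fun t => l1Norm (x t)) (Set.Ici a) := by
    refine antitoneOn_of_ae_deriv_nonpos hW (hderiv.mono fun t ht hat => ?_)
    obtain ⟨φ, -, -, hd⟩ := ht hat
    rw [hd]
    have := hk0 t hat
    simp only [Left.neg_nonpos_iff]
    positivity
  have hsub : ∀ t, a ≤ t → x t - x T ∈ K := fun t ht => by
    simpa using K.sub_mem (hxK t ht) (hxK T hT)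
  have hconst : ∀ t, T ≤ t → l1Norm (x t) = l1Norm (x T) := fun t ht =>
    le_antisymm (hanti hT (hT.trans ht) ht) (hmin _ (hsub t (hT.trans ht)))
  -- The constant norm has derivative `-k ‖P φ‖² = 0`, so the velocity `-k P φ` vanishes. Strictness
  -- of `T < t` gives constancy on both sides of `t`.
  have hzero : ∀ᵐ t, T < t → HasDerivAt x 0 t := by
    filter_upwards [hderiv] with t ht hTt
    obtain ⟨φ, -, hxt, hd⟩ := ht (hT.trans hTt.le)
    have h1 : deriv (fun t => l1Norm (x t)) t = 0 := by
      have : (fun t => l1Norm (x t)) =ᶠ[𝓝 t] fun _ => l1Norm (x T) :=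
        (eventually_gt_nhds hTt).mono fun s hs => hconst s hs.le
      rw [this.deriv_eq, deriv_const]
    have h2 : k t • K.starProjection φ = 0 := by
      rw [h1] at hd
      rcases mul_eq_zero.1 (neg_eq_zero.1 hd.symm) with h | h
      · simp [h]
      · simp [norm_eq_zero.1 (pow_eq_zero_iff two_ne_zero |>.1 h)]
    rwa [h2, neg_zero] at hxt
  refine ⟨T, hT, fun t ht => ?_, fun z hz => hmin z ?_⟩
  · have hac : AbsolutelyContinuousOnInterval x T t := (hx t (hT.trans ht)).mono (by
      rw [Set.uIcc_of_le ht, Set.uIcc_of_le (hT.trans ht)]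
      exact Set.Icc_subset_Icc_left hT)
    obtain ⟨C, hC⟩ := hac.const_of_ae_hasDerivAt_zero (by
      filter_upwards [hzero, Measure.ae_ne volume T] with s hs hne hmem
      rw [Set.uIcc_of_le ht] at hmem
      exact hs (hmem.1.lt_of_ne hne.symm))
    rw [hC t Set.right_mem_uIcc, hC T Set.left_mem_uIcc]
  · have := K.sub_mem hz (hxK T hT)
    simpa using this

/-! ### The kernel projections -/

theorem mem_ker_toLpLin_iff {s n : ℕ} {M : Matrix (Fin s) (Fin n) ℝ}
    {z : EuclideanSpace ℝ (Fin n)} :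
    z ∈ LinearMap.ker (Matrix.toLpLin 2 2 M) ↔ M.mulVec z.ofLp = 0 := by
  rw [LinearMap.mem_ker, Matrix.toLpLin_apply, WithLp.toLp_eq_zero]

theorem mulVec_kerProj {s n : ℕ} (M : Matrix (Fin s) (Fin n) ℝ) (z : EuclideanSpace ℝ (Fin n)) :
    M.mulVec (kerProj M z).ofLp = 0 :=
  mem_ker_toLpLin_iff.1 (Submodule.starProjection_apply_mem _ z)

theorem inner_kerProj_right {s n : ℕ} (M : Matrix (Fin s) (Fin n) ℝ)
    (w z : EuclideanSpace ℝ (Fin n)) :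
    inner ℝ w (kerProj M z) = inner ℝ (kerProj M w) (kerProj M z) := by
  rw [kerProj, Submodule.inner_starProjection_left_eq_right,
    Submodule.starProjection_eq_self_iff.2 (Submodule.starProjection_apply_mem _ z)]

theorem inner_of_mulVec_eq_zero {s n : ℕ} {M : Matrix (Fin s) (Fin n) ℝ}
    (w : EuclideanSpace ℝ (Fin n)) {z : EuclideanSpace ℝ (Fin n)} (hz : M.mulVec z.ofLp = 0) :
    inner ℝ w z = inner ℝ (kerProj M w) z := by
  rw [kerProj, Submodule.inner_starProjection_left_eq_right,
    Submodule.starProjection_eq_self_iff.2 (mem_ker_toLpLin_iff.2 hz)]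

theorem norm_kerProj_le {s n : ℕ} (M : Matrix (Fin s) (Fin n) ℝ)
    (z : EuclideanSpace ℝ (Fin n)) : ‖kerProj M z‖ ≤ ‖z‖ :=
  Submodule.norm_starProjection_apply_le _ z

/-! ### The disagreement function -/

/-- The total `l₁` disagreement between neighbors, every edge being counted twice. -/
noncomputable def disagreement {m n : ℕ} (G : SimpleGraph (Fin m)) [DecidableRel G.Adj]
    (y : Fin m → EuclideanSpace ℝ (Fin n)) : ℝ :=
  ∑ i, ∑ j ∈ G.neighborFinset i, l1Norm (y i - y j)

section disagreement

variable {m n : ℕ} (G : SimpleGraph (Fin m)) [DecidableRel G.Adj]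

theorem disagreement_nonneg (y : Fin m → EuclideanSpace ℝ (Fin n)) : 0 ≤ disagreement G y :=
  Finset.sum_nonneg fun _ _ => Finset.sum_nonneg fun _ _ => l1Norm_nonneg _

theorem norm_sub_le_disagreement {i j : Fin m} (h : G.Adj i j)
    (y : Fin m → EuclideanSpace ℝ (Fin n)) : ‖y i - y j‖ ≤ disagreement G y := by
  refine (norm_le_l1Norm _).trans ?_
  calc l1Norm (y i - y j) ≤ ∑ j ∈ G.neighborFinset i, l1Norm (y i - y j) :=
        Finset.single_le_sum (f := fun j => l1Norm (y i - y j)) (fun _ _ => l1Norm_nonneg _)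
          ((G.mem_neighborFinset i j).2 h)
    _ ≤ disagreement G y :=
        Finset.single_le_sum (f := fun i => ∑ j ∈ G.neighborFinset i, l1Norm (y i - y j))
          (fun _ _ => Finset.sum_nonneg fun _ _ => l1Norm_nonneg _) (Finset.mem_univ i)

theorem norm_sub_le_length_mul_disagreement {i j : Fin m} (p : G.Walk i j)
    (y : Fin m → EuclideanSpace ℝ (Fin n)) : ‖y i - y j‖ ≤ p.length * disagreement G y := by
  induction p with
  | nil => simp
  | @cons u v w h p ih =>
    calc ‖y u - y w‖ ≤ ‖y u - y v‖ + ‖y v - y w‖ := norm_sub_le_norm_sub_add_norm_sub _ _ _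
      _ ≤ disagreement G y + p.length * disagreement G y :=
        add_le_add (norm_sub_le_disagreement G h y) ih
      _ = _ := by
        rw [SimpleGraph.Walk.length_cons]
        push_cast
        ring

theorem exists_norm_sub_le_mul_disagreement (n : ℕ) (hG : G.Connected) :
    ∃ C : ℝ, 0 ≤ C ∧ ∀ (y : Fin m → EuclideanSpace ℝ (Fin n)) (i j : Fin m),
      ‖y i - y j‖ ≤ C * disagreement G y := by
  let p : ∀ i j, G.Walk i j := fun i j => (hG.preconnected i j).some
  -- The sum of all chosen walk lengths dominates each of them.
  refine ⟨∑ i, ∑ j, ((p i j).length : ℝ), by positivity, fun y i j => ?_⟩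
  refine (norm_sub_le_length_mul_disagreement G (p i j) y).trans
    (mul_le_mul_of_nonneg_right ?_ (disagreement_nonneg G y))
  calc ((p i j).length : ℝ) ≤ ∑ j, ((p i j).length : ℝ) :=
        Finset.single_le_sum (f := fun j => ((p i j).length : ℝ)) (fun _ _ => by positivity)
          (Finset.mem_univ j)
    _ ≤ _ := Finset.single_le_sum (f := fun i => ∑ j, ((p i j).length : ℝ))
          (fun _ _ => by positivity) (Finset.mem_univ i)

theorem sum_neighborFinset_comm (f : Fin m → Fin m → ℝ) :
    ∑ i, ∑ j ∈ G.neighborFinset i, f i j = ∑ i, ∑ j ∈ G.neighborFinset i, f j i := by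
  rw [Finset.sum_comm' (t' := Finset.univ) (s' := fun j => G.neighborFinset j)]
  intro i j
  simp [G.adj_comm]

variable {G}

/-- Antisymmetry of `ψ` turns the `z j - y j` half of the linear term into a second copy of the `z i
- y i` half, whence the factor `2`. -/
theorem disagreement_add_inner_le {y z : Fin m → EuclideanSpace ℝ (Fin n)}
    {ψ : Fin m → Fin m → EuclideanSpace ℝ (Fin n)}
    (hψ : ∀ i j, G.Adj i j → IsSignSelection (ψ i j) (y i - y j) ∧ ψ i j = -ψ j i) :
    disagreement G y + 2 * ∑ i, inner ℝ (∑ j ∈ G.neighborFinset i, ψ i j) (z i - y i) ≤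
      disagreement G z := by
  have h1 : disagreement G y +
      ∑ i, ∑ j ∈ G.neighborFinset i, inner ℝ (ψ i j) ((z i - z j) - (y i - y j)) ≤
      disagreement G z := by
    rw [disagreement, disagreement, ← Finset.sum_add_distrib]
    refine Finset.sum_le_sum fun i _ => ?_
    rw [← Finset.sum_add_distrib]
    refine Finset.sum_le_sum fun j hj => ?_
    exact (hψ i j ((G.mem_neighborFinset i j).1 hj)).1.l1Norm_add_inner_le _
  have h2 : ∑ i, ∑ j ∈ G.neighborFinset i, inner ℝ (ψ i j) (z j - y j) =
      -∑ i, ∑ j ∈ G.neighborFinset i, inner ℝ (ψ i j) (z i - y i) := by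
    rw [sum_neighborFinset_comm, ← Finset.sum_neg_distrib]
    refine Finset.sum_congr rfl fun i _ => ?_
    rw [← Finset.sum_neg_distrib]
    refine Finset.sum_congr rfl fun j hj => ?_
    rw [(hψ i j ((G.mem_neighborFinset i j).1 hj)).2, inner_neg_left, neg_neg]
  have h3 : ∑ i, ∑ j ∈ G.neighborFinset i, inner ℝ (ψ i j) ((z i - z j) - (y i - y j)) =
      2 * ∑ i, inner ℝ (∑ j ∈ G.neighborFinset i, ψ i j) (z i - y i) := by
    have : ∀ i j, inner ℝ (ψ i j) ((z i - z j) - (y i - y j)) =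
        inner ℝ (ψ i j) (z i - y i) - inner ℝ (ψ i j) (z j - y j) := by
      intro i j
      rw [← inner_sub_right]
      congr 1
      abel
    simp only [this, Finset.sum_sub_distrib, h2, sum_inner]
    ring
  rwa [h3] at h1

theorem sum_sum_neighborFinset_eq_zero {ψ : Fin m → Fin m → EuclideanSpace ℝ (Fin n)}
    (hψ : ∀ i j, G.Adj i j → ψ i j = -ψ j i) : ∑ i, ∑ j ∈ G.neighborFinset i, ψ i j = 0 := by
  ext l
  have h1 : ∑ i, ∑ j ∈ G.neighborFinset i, ψ i j l =
      -∑ i, ∑ j ∈ G.neighborFinset i, ψ i j l := by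
    conv_lhs => rw [sum_neighborFinset_comm]
    simp only [← Finset.sum_neg_distrib]
    refine Finset.sum_congr rfl fun i _ => Finset.sum_congr rfl fun j hj => ?_
    rw [hψ i j ((G.mem_neighborFinset i j).1 hj), PiLp.neg_apply, neg_neg]
  simp only [WithLp.ofLp_sum, Finset.sum_apply, PiLp.zero_apply]
  linarith

end disagreement

/-! ### The error bound for the consensus solutions -/

theorem Matrix.mulVec_surjective_of_rank_eq_card {ι κ : Type*} [Fintype ι] [Fintype κ]
    {A : Matrix ι κ ℝ} (h : A.rank = Fintype.card ι) : Function.Surjective A.mulVecLin := by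
  rw [← LinearMap.range_eq_top]
  refine Submodule.eq_top_of_finrank_eq ?_
  rw [Module.finrank_fintype_fun_eq_card]
  exact h

/-- A right inverse of the stacked matrix yields a linear correction, of size proportional to the
disagreement, that moves one agent's state onto all the constraints. Linearity makes `C` independent
of `b`. -/
theorem exists_norm_sub_solution_le_mul_disagreement {m n : ℕ} {r : Fin m → ℕ}
    {G : SimpleGraph (Fin m)} [DecidableRel G.Adj] (hG : G.Connected)
    {A : (i : Fin m) → Matrix (Fin (r i)) (Fin n) ℝ}
    (hA : (stackMatrix A).rank = ∑ i, r i) :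
    ∃ C : ℝ, 0 < C ∧ ∀ (b : (i : Fin m) → Fin (r i) → ℝ) (y : Fin m → EuclideanSpace ℝ (Fin n)),
      (∀ i, (A i).mulVec (y i).ofLp = b i) → ∃ x : EuclideanSpace ℝ (Fin n),
        (∀ i, (A i).mulVec x.ofLp = b i) ∧ ∀ i, ‖y i - x‖ ≤ C * disagreement G y := by
  obtain ⟨C, hC, hy⟩ := exists_norm_sub_le_mul_disagreement G n hG
  obtain ⟨R, hR⟩ := (stackMatrix A).mulVecLin.exists_rightInverse_of_surjective
    (LinearMap.range_eq_top.2
      (Matrix.mulVec_surjective_of_rank_eq_card (by simpa using hA)))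
  -- `L` stacks the vectors `A_i z_i`; composed with the right inverse it gives `S` with `A_i (S z)
  -- = A_i z_i` for all `i`.
  let L : (Fin m → EuclideanSpace ℝ (Fin n)) →ₗ[ℝ] (Σ i, Fin (r i)) → ℝ :=
    LinearMap.pi fun p => (LinearMap.proj p.2).comp
      ((A p.1).mulVecLin.comp ((WithLp.linearEquiv 2 ℝ (Fin n → ℝ)).toLinearMap.comp
        (LinearMap.proj p.1)))
  have hL : ∀ z p, L z p = (A p.1).mulVec (z p.1).ofLp p.2 := fun z p => rfl
  let S : (Fin m → EuclideanSpace ℝ (Fin n)) →L[ℝ] EuclideanSpace ℝ (Fin n) :=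
    LinearMap.toContinuousLinearMap
      ((WithLp.linearEquiv 2 ℝ (Fin n → ℝ)).symm.toLinearMap.comp (R.comp L))
  have hS : ∀ z i, (A i).mulVec (S z).ofLp = (A i).mulVec (z i).ofLp := by
    intro z i
    ext q
    have := congrFun (LinearMap.congr_fun hR (L z)) ⟨i, q⟩
    exact this
  have i₀ : Fin m := hG.nonempty.some
  refine ⟨C + ‖S‖ * C + 1, by positivity, fun b y hb => ?_⟩
  set z : Fin m → EuclideanSpace ℝ (Fin n) := fun i => y i₀ - y i
  refine ⟨y i₀ - S z, fun i => ?_, fun i => ?_⟩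
  · rw [WithLp.ofLp_sub, Matrix.mulVec_sub, hS, ← Matrix.mulVec_sub, ← WithLp.ofLp_sub]
    simp [z, hb]
  · have hV := disagreement_nonneg G y
    have hz : ‖z‖ ≤ C * disagreement G y :=
      (pi_norm_le_iff_of_nonneg (by positivity)).2 fun j => hy y i₀ j
    calc ‖y i - (y i₀ - S z)‖ = ‖(y i - y i₀) + S z‖ := by congr 1; abel
      _ ≤ ‖y i - y i₀‖ + ‖S z‖ := norm_add_le _ _
      _ ≤ C * disagreement G y + ‖S‖ * (C * disagreement G y) :=
        add_le_add (hy y i i₀) ((S.le_opNorm z).trans (by gcongr))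
      _ ≤ _ := by nlinarith

/-- Away from consensus, the projected subgradients of the disagreement are bounded below. -/
theorem exists_le_sum_norm_sq_kerProj {m n : ℕ} {r : Fin m → ℕ}
    {G : SimpleGraph (Fin m)} [DecidableRel G.Adj] (hG : G.Connected)
    {A : (i : Fin m) → Matrix (Fin (r i)) (Fin n) ℝ}
    (hA : (stackMatrix A).rank = ∑ i, r i) :
    ∃ c : ℝ, 0 < c ∧ ∀ (b : (i : Fin m) → Fin (r i) → ℝ) (y : Fin m → EuclideanSpace ℝ (Fin n))
      (ψ : Fin m → Fin m → EuclideanSpace ℝ (Fin n)),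
      (∀ i, (A i).mulVec (y i).ofLp = b i) → 0 < disagreement G y →
      (∀ i j, G.Adj i j → IsSignSelection (ψ i j) (y i - y j) ∧ ψ i j = -ψ j i) →
      c ≤ ∑ i, ‖kerProj (A i) (∑ j ∈ G.neighborFinset i, ψ i j)‖ ^ 2 := by
  obtain ⟨C, hC, h⟩ := exists_norm_sub_solution_le_mul_disagreement hG hA
  have hm : 0 < m := Fin.pos hG.nonempty.some
  refine ⟨1 / ((2 * C) ^ 2 * m), by positivity, fun b y ψ hb hV hψ => ?_⟩
  obtain ⟨x, hx, hyx⟩ := h b y hb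
  set g : Fin m → EuclideanSpace ℝ (Fin n) := fun i => ∑ j ∈ G.neighborFinset i, ψ i j
  -- Comparison with the consensus point `x`, where the disagreement is zero. Since `x - y i` lies
  -- in `ker A_i`, only the projection of `g i` matters.
  have h1 := disagreement_add_inner_le (z := fun _ => x) hψ
  have h0 : disagreement G (fun _ : Fin m => x) = 0 := by simp [disagreement, l1Norm]
  have h2 : ∀ i, -inner ℝ (g i) (x - y i) ≤ ‖kerProj (A i) (g i)‖ * (C * disagreement G y) := by
    intro i
    rw [inner_of_mulVec_eq_zero (M := A i) (g i)
      (by rw [WithLp.ofLp_sub, Matrix.mulVec_sub, hx, hb, sub_self]), ← inner_neg_right, neg_sub]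
    exact (real_inner_le_norm _ _).trans (by gcongr; exact hyx i)
  have h3 : disagreement G y ≤
      2 * ((∑ i, ‖kerProj (A i) (g i)‖) * (C * disagreement G y)) := by
    have := Finset.sum_le_sum fun i (_ : i ∈ Finset.univ) => h2 i
    rw [Finset.sum_neg_distrib, ← Finset.sum_mul] at this
    linarith
  -- Both sides of `h3` are proportional to the disagreement, which cancels; Cauchy–Schwarz then
  -- passes to the sum of squares.
  have h4 : 1 ≤ 2 * C * ∑ i, ‖kerProj (A i) (g i)‖ := by
    refine le_of_mul_le_mul_right ?_ hV
    linarith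
  have h5 := sq_sum_le_card_mul_sum_sq (s := Finset.univ) (f := fun i => ‖kerProj (A i) (g i)‖)
  rw [Finset.card_univ, Fintype.card_fin] at h5
  rw [div_le_iff₀ (by positivity)]
  calc (1 : ℝ) ≤ (2 * C * ∑ i, ‖kerProj (A i) (g i)‖) ^ 2 := one_le_pow₀ h4
    _ = (2 * C) ^ 2 * (∑ i, ‖kerProj (A i) (g i)‖) ^ 2 := by ring
    _ ≤ (2 * C) ^ 2 * (m * ∑ i, ‖kerProj (A i) (g i)‖ ^ 2) := by gcongr
    _ = _ := by ring

/-! ### The distributed update -/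

section update

variable {m n : ℕ} {r : Fin m → ℕ} {G : SimpleGraph (Fin m)} [DecidableRel G.Adj]
  {A : (i : Fin m) → Matrix (Fin (r i)) (Fin n) ℝ} {b : (i : Fin m) → Fin (r i) → ℝ}
  {k : ℝ → ℝ} {y : Fin m → ℝ → EuclideanSpace ℝ (Fin n)}

theorem AbsolutelyContinuousOnInterval.disagreement_comp {a T : ℝ}
    (hy : ∀ i, AbsolutelyContinuousOnInterval (y i) a T) :
    AbsolutelyContinuousOnInterval (fun t => disagreement G fun i => y i t) a T := by
  simp only [disagreement]
  exact AbsolutelyContinuousOnInterval.finset_sum _ fun i _ =>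
    AbsolutelyContinuousOnInterval.finset_sum _ fun j _ => ((hy i).fun_sub (hy j)).l1Norm_comp

theorem IsDistributedL1Solution.absCont_of_le (hy : IsDistributedL1Solution G A b k y) {a T : ℝ}
    (ha : 0 ≤ a) (haT : a ≤ T) (i : Fin m) : AbsolutelyContinuousOnInterval (y i) a T :=
  (hy.absCont i T (ha.trans haT)).mono (by
    rw [Set.uIcc_of_le haT, Set.uIcc_of_le (ha.trans haT)]
    exact Set.Icc_subset_Icc_left ha)

/-- The velocity of agent `i` lies in the range of `P_i`, that is, in `ker A_i`. -/
theorem IsDistributedL1Solution.mulVec_eq (hy : IsDistributedL1Solution G A b k y) {t : ℝ}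
    (ht : 0 ≤ t) (i : Fin m) : (A i).mulVec (y i t).ofLp = b i := by
  let M := LinearMap.toContinuousLinearMap (Matrix.toLpLin 2 2 (A i))
  have hM : ∀ z, M z = WithLp.toLp 2 ((A i).mulVec z.ofLp) := fun z => rfl
  obtain ⟨C, hC⟩ := ((hy.absCont i t ht).lipschitz_comp M.lipschitz).const_of_ae_hasDerivAt_zero
    (by
      filter_upwards [hy.update] with s hs hmem
      rw [Set.uIcc_of_le ht] at hmem
      obtain ⟨φ, ψ, -, -, hd⟩ := hs hmem.1
      have h1 := M.hasFDerivAt.comp_hasDerivAt s (hd i)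
      have h2 : M (-(k s • kerProj (A i) (φ i)) -
          kerProj (A i) (∑ j ∈ G.neighborFinset i, ψ i j)) = 0 := by
        rw [map_sub, map_neg, map_smul, hM, hM, mulVec_kerProj, mulVec_kerProj]
        simp
      rwa [h2] at h1)
  have h1 : M (y i t) = M (y i 0) :=
    (hC t Set.right_mem_uIcc).trans (hC 0 Set.left_mem_uIcc).symm
  rw [hM, hM, hy.init] at h1
  simpa using h1

/-- Completing the square: `2⟪Pg, -κPφ - Pg⟫ = κ²‖Pφ‖² - ‖Pg‖² - ‖Pg + κPφ‖²`. -/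
theorem two_mul_sum_inner_update_le {φ g : Fin m → EuclideanSpace ℝ (Fin n)} (κ : ℝ)
    (hφ : ∀ i, ‖φ i‖ ^ 2 ≤ n) :
    2 * ∑ i, inner ℝ (g i) (-(κ • kerProj (A i) (φ i)) - kerProj (A i) (g i)) ≤
      κ ^ 2 * (n * m) - ∑ i, ‖kerProj (A i) (g i)‖ ^ 2 := by
  have h1 : ∀ i, 2 * inner ℝ (g i) (-(κ • kerProj (A i) (φ i)) - kerProj (A i) (g i)) ≤
      κ ^ 2 * n - ‖kerProj (A i) (g i)‖ ^ 2 := by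
    intro i
    rw [inner_sub_right, inner_neg_right, inner_smul_right, inner_kerProj_right,
      inner_kerProj_right (A i) (g i) (g i), real_inner_self_eq_norm_sq]
    have h2 : ‖kerProj (A i) (φ i)‖ ^ 2 ≤ n :=
      (pow_le_pow_left₀ (norm_nonneg _) (norm_kerProj_le _ _) 2).trans (hφ i)
    have h3 := norm_add_sq_real (kerProj (A i) (g i)) (κ • kerProj (A i) (φ i))
    rw [inner_smul_right, norm_smul, mul_pow, Real.norm_eq_abs, sq_abs] at h3
    have h4 : 0 ≤ ‖kerProj (A i) (g i) + κ • kerProj (A i) (φ i)‖ ^ 2 := by positivity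
    have h5 : κ ^ 2 * ‖kerProj (A i) (φ i)‖ ^ 2 ≤ κ ^ 2 * n := by gcongr
    linarith
  rw [Finset.mul_sum]
  refine (Finset.sum_le_sum fun i _ => h1 i).trans_eq ?_
  rw [Finset.sum_sub_distrib]
  simp
  ring

/-- The agents reach consensus in finite time if the gain is small from some time on. -/
theorem IsDistributedL1Solution.eventually_disagreement_eq_zero
    (hy : IsDistributedL1Solution G A b k y) {a c : ℝ} (ha : 0 ≤ a) (hc : 0 < c)
    (hsharp : ∀ (z : Fin m → EuclideanSpace ℝ (Fin n))
      (ψ : Fin m → Fin m → EuclideanSpace ℝ (Fin n)),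
      (∀ i, (A i).mulVec (z i).ofLp = b i) → 0 < disagreement G z →
      (∀ i j, G.Adj i j → IsSignSelection (ψ i j) (z i - z j) ∧ ψ i j = -ψ j i) →
      c ≤ ∑ i, ‖kerProj (A i) (∑ j ∈ G.neighborFinset i, ψ i j)‖ ^ 2)
    (hk : ∀ t, a ≤ t → k t ^ 2 * (n * m) ≤ c / 2) :
    ∃ T, a ≤ T ∧ ∀ t, T ≤ t → disagreement G (fun i => y i t) = 0 := by
  have hV : ∀ T, a ≤ T →
      AbsolutelyContinuousOnInterval (fun t => disagreement G fun i => y i t) a T :=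
    fun T hT => AbsolutelyContinuousOnInterval.disagreement_comp fun i => hy.absCont_of_le ha hT i
  refine eventually_eq_zero_of_deriv_le (half_pos hc) hV (fun t => disagreement_nonneg G _) ?_
  filter_upwards [hy.update, ae_differentiableAt_of_forall_absolutelyContinuous hV]
    with t ht hdiff hat hpos
  obtain ⟨φ, ψ, hφ, hψ, hd⟩ := ht (ha.trans hat)
  have hψ' : ∀ i j, G.Adj i j → IsSignSelection (ψ i j) (y i t - y j t) ∧ ψ i j = -ψ j i :=
    fun i j h => ⟨isSignSelection_of_mem_filippovMap (hψ i j h).1, (hψ i j h).2⟩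
  -- Pairing with the subgradient `2 g` of the disagreement.
  let L : (Fin m → EuclideanSpace ℝ (Fin n)) →L[ℝ] ℝ :=
    (2 : ℝ) • ∑ i, (innerSL ℝ (∑ j ∈ G.neighborFinset i, ψ i j)).comp (ContinuousLinearMap.proj i)
  have hL : ∀ z, L z = 2 * ∑ i, inner ℝ (∑ j ∈ G.neighborFinset i, ψ i j) (z i) := by
    intro z
    simp [L, sum_inner]
  rw [deriv_comp_eq_of_subgradient (f := disagreement G) (y := fun t i => y i t) L (fun z => by
    rw [hL]
    exact disagreement_add_inner_le hψ') (hasDerivAt_pi.2 hd) (hdiff hat), hL]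
  refine (two_mul_sum_inner_update_le (k t) fun i =>
    (isSignSelection_of_mem_filippovMap (hφ i)).norm_sq_le).trans ?_
  have h1 := hsharp (fun i => y i t) ψ (fun i => hy.mulVec_eq (ha.trans hat) i) hpos hψ'
  linarith [hk t hat]

/-- After consensus the common state follows the projected `l₁` subgradient flow. -/
theorem IsDistributedL1Solution.hasDerivAt_of_consensus (hm : 0 < m)
    (hy : IsDistributedL1Solution G A b k y) {x : ℝ → EuclideanSpace ℝ (Fin n)} {a : ℝ}
    (ha : 0 ≤ a) (hx : ∀ t, a ≤ t → ∀ i, y i t = x t) :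
    ∀ᵐ t, a ≤ t → ∃ φ, IsSignSelection φ (x t) ∧ HasDerivAt x
      (-(k t • (⨅ i, LinearMap.ker (Matrix.toLpLin 2 2 (A i))).starProjection φ)) t := by
  set K : Submodule ℝ (EuclideanSpace ℝ (Fin n)) :=
    ⨅ i, LinearMap.ker (Matrix.toLpLin 2 2 (A i)) with hK
  -- `K ⊆ ker A_i`, so projecting onto `K` absorbs each `P_i`.
  have hPP : ∀ i z, K.starProjection (kerProj (A i) z) = K.starProjection z := fun i z =>
    DFunLike.congr_fun (Submodule.starProjection_comp_starProjection_of_le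
      (U := K) (V := LinearMap.ker (Matrix.toLpLin 2 2 (A i))) (iInf_le _ i)) z
  -- The time `a` is discarded because a two-sided derivative needs consensus on both sides of `t`.
  filter_upwards [hy.update, Measure.ae_ne volume a] with t ht hne hat
  obtain ⟨φ, ψ, hφ, hψ, hd⟩ := ht (ha.trans hat)
  have hxd : ∀ i, HasDerivAt x (-(k t • kerProj (A i) (φ i)) -
      kerProj (A i) (∑ j ∈ G.neighborFinset i, ψ i j)) t := fun i =>
    (hd i).congr_of_eventuallyEq
      ((eventually_gt_nhds (hat.lt_of_ne hne.symm)).mono fun s hs => (hx s hs.le i).symm)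
  obtain ⟨v, hv⟩ : ∃ v, HasDerivAt x v t := ⟨_, hxd ⟨0, hm⟩⟩
  have hvi : ∀ i, v = -(k t • kerProj (A i) (φ i)) -
      kerProj (A i) (∑ j ∈ G.neighborFinset i, ψ i j) := fun i => hv.unique (hxd i)
  have hvK : K.starProjection v = v := by
    refine Submodule.starProjection_eq_self_iff.2 ((Submodule.mem_iInf _).2 fun i => ?_)
    rw [hvi i]
    exact Submodule.sub_mem _ (Submodule.neg_mem _ (Submodule.smul_mem _ _
      (Submodule.starProjection_apply_mem _ _))) (Submodule.starProjection_apply_mem _ _)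
  have hm' : (m : ℝ) ≠ 0 := by positivity
  have hsum : (m : ℝ) • v = -(k t • K.starProjection (∑ i, φ i)) := by
    calc (m : ℝ) • v = ∑ _i : Fin m, K.starProjection v := by
          rw [hvK, Finset.sum_const, Finset.card_univ, Fintype.card_fin, Nat.cast_smul_eq_nsmul]
      _ = ∑ i, (-(k t • K.starProjection (φ i)) -
            K.starProjection (∑ j ∈ G.neighborFinset i, ψ i j)) := by
          refine Finset.sum_congr rfl fun i _ => ?_
          rw [hvi i, map_sub, map_neg, map_smul, hPP, hPP]
      _ = -(k t • K.starProjection (∑ i, φ i)) := by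
          rw [Finset.sum_sub_distrib, ← map_sum,
            sum_sum_neighborFinset_eq_zero fun i j h => (hψ i j h).2, map_zero, sub_zero,
            Finset.sum_neg_distrib, ← Finset.smul_sum, map_sum]
  -- The mean of the agents' subgradients is again a subgradient, by convexity of the
  -- subdifferential.
  refine ⟨(m : ℝ)⁻¹ • ∑ i, φ i, ⟨fun l => ?_, fun l => ?_⟩, ?_⟩
  · have h1 : |∑ i, φ i l| ≤ m := by
      refine (Finset.abs_sum_le_sum_abs _ _).trans ?_
      calc ∑ i, |φ i l| ≤ ∑ _i : Fin m, (1 : ℝ) :=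
            Finset.sum_le_sum fun i _ => (isSignSelection_of_mem_filippovMap (hφ i)).1 l
        _ = m := by simp
    simp only [PiLp.smul_apply, WithLp.ofLp_sum, Finset.sum_apply, smul_eq_mul]
    rw [abs_mul, abs_inv, Nat.abs_cast, inv_mul_le_iff₀ (by positivity), mul_one]
    exact h1
  · simp only [PiLp.smul_apply, WithLp.ofLp_sum, Finset.sum_apply, smul_eq_mul]
    rw [mul_assoc, Finset.sum_mul, inv_mul_eq_iff_eq_mul₀ hm']
    calc ∑ i, φ i l * x t l = ∑ _i : Fin m, |x t l| := by
          refine Finset.sum_congr rfl fun i _ => ?_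
          have := (isSignSelection_of_mem_filippovMap (hφ i)).2 l
          rwa [hx t hat i] at this
      _ = m * |x t l| := by simp
  · convert hv using 1
    rw [map_smul, smul_comm, ← smul_neg, ← hsum, inv_smul_smul₀ hm']

end update

theorem theorem3 {m n : ℕ} {r : Fin m → ℕ}
    (G : SimpleGraph (Fin m)) [DecidableRel G.Adj] (hG : G.Connected)
    (A : (i : Fin m) → Matrix (Fin (r i)) (Fin n) ℝ)
    (hA : (stackMatrix A).rank = ∑ i, r i) :
    ∃ δ₀ : ℝ, 0 < δ₀ ∧
      ∀ (b : (i : Fin m) → Fin (r i) → ℝ) (k : ℝ → ℝ) (δ : ℝ),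
        0 ≤ δ → δ < δ₀ →
        AEMeasurable k (volume.restrict (Set.Ici 0)) →
        (∀ T : ℝ, ∃ C : ℝ, ∀ᵐ t : ℝ, t ∈ Set.Icc 0 T → |k t| ≤ C) →
        Tendsto k atTop (𝓝 δ) →
        Tendsto (fun T : ℝ => ∫ t in (0 : ℝ)..T, k t) atTop atTop →
        (∀ᶠ t in atTop, 0 ≤ k t) →
        ∀ y : Fin m → ℝ → EuclideanSpace ℝ (Fin n),
          IsDistributedL1Solution G A b k y →
          ∃ x : EuclideanSpace ℝ (Fin n), IsMinL1Solution (stackMatrix A) (stackVec b) x ∧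
            ∃ T : ℝ, 0 ≤ T ∧ ∀ t : ℝ, T ≤ t → ∀ i, y i t = x := by
  obtain ⟨c, hc, hsharp⟩ := exists_le_sum_norm_sq_kerProj hG hA
  obtain ⟨C, hC, hdis⟩ := exists_norm_sub_le_mul_disagreement G n hG
  have i₀ : Fin m := hG.nonempty.some
  -- Chosen so that `0 ≤ k < δ₀` gives `k² n m ≤ c / 2`; the `+ 1` keeps the denominator positive
  -- when `n = 0`.
  refine ⟨Real.sqrt (c / (2 * (n * m + 1))), Real.sqrt_pos.2 (by positivity), ?_⟩
  intro b k δ _ hδ hkm hkb hkδ hkint hk0 y hy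
  obtain ⟨T₁, hT₁⟩ := eventually_atTop.1
    ((hk0.and (hkδ.eventually_lt_const hδ)).and (eventually_ge_atTop 0))
  have hT₁0 : 0 ≤ T₁ := (hT₁ T₁ le_rfl).2
  have hksq : ∀ t, T₁ ≤ t → k t ^ 2 * (n * m) ≤ c / 2 := by
    intro t ht
    have h1 : k t ^ 2 ≤ c / (2 * (n * m + 1)) := by
      rw [← Real.sq_sqrt (show 0 ≤ c / (2 * (n * m + 1)) by positivity)]
      exact pow_le_pow_left₀ (hT₁ t ht).1.1 (hT₁ t ht).1.2.le 2
    calc k t ^ 2 * (n * m) ≤ c / (2 * (n * m + 1)) * (n * m + 1) := by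
          gcongr
          linarith
      _ = c / 2 := by field_simp
  obtain ⟨T₂, hT₁₂, hT₂⟩ :=
    hy.eventually_disagreement_eq_zero hT₁0 hc (hsharp b) hksq
  have hT₂0 : 0 ≤ T₂ := hT₁0.trans hT₁₂
  have hcons : ∀ t, T₂ ≤ t → ∀ i, y i t = y i₀ t := by
    intro t ht i
    have := hdis (fun i => y i t) i i₀
    rw [hT₂ t ht, mul_zero] at this
    exact sub_eq_zero.1 (norm_le_zero_iff.1 this)
  have hkI : ∀ T, 0 ≤ T → IntervalIntegrable k volume 0 T := by
    intro T hT
    rw [intervalIntegrable_iff_integrableOn_Icc_of_le hT]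
    obtain ⟨B, hB⟩ := hkb T
    exact Integrable.of_bound
      (hkm.mono_measure (Measure.restrict_mono Set.Icc_subset_Ici_self le_rfl)).aestronglyMeasurable
      B ((ae_restrict_iff' measurableSet_Icc).2 hB)
  have hmem : ∀ t, T₂ ≤ t → ∀ i, (A i).mulVec (y i₀ t).ofLp = b i := fun t ht i => by
    rw [← hcons t ht i]
    exact hy.mulVec_eq (hT₂0.trans ht) i
  obtain ⟨T, hT, hconst, hmin⟩ := eventually_const_minimizer_of_projected_flow
    (⨅ i, LinearMap.ker (Matrix.toLpLin 2 2 (A i))) (x := y i₀) (k := k) (a := T₂)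
    (fun T hT => hy.absCont_of_le hT₂0 hT i₀)
    (fun t ht => (Submodule.mem_iInf _).2 fun i => mem_ker_toLpLin_iff.2 (by
      rw [WithLp.ofLp_sub, Matrix.mulVec_sub, hmem t ht, hmem T₂ le_rfl, sub_self]))
    (fun T hT => (hkI T₂ hT₂0).symm.trans (hkI T (hT₂0.trans hT)))
    (fun t ht => (hT₁ t (hT₁₂.trans ht)).1.1)
    -- Discarding the integral over `[0, T₂]`, a finite constant, leaves the tail divergent.
    ((tendsto_atTop_add_const_right _ (-∫ t in (0 : ℝ)..T₂, k t) hkint).congr'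
      ((eventually_ge_atTop 0).mono fun T hT => by
        rw [← sub_eq_add_neg]
        exact intervalIntegral.integral_interval_sub_left (hkI T hT) (hkI T₂ hT₂0)))
    (hy.hasDerivAt_of_consensus (Fin.pos i₀) hT₂0 hcons)
  have hsol : ∀ w : EuclideanSpace ℝ (Fin n),
      (stackMatrix A).mulVec w.ofLp = stackVec b ↔ ∀ i, (A i).mulVec w.ofLp = b i := by
    intro w
    constructor
    · exact fun h i => funext fun q => congrFun h ⟨i, q⟩
    · exact fun h => funext fun p => congrFun (h p.1) p.2
  refine ⟨y i₀ T, ⟨(hsol _).2 (hmem T hT), fun w hw => hmin w ?_⟩, T, hT₂0.trans hT,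
    fun t ht i => (hcons t (hT.trans ht) i).trans (hconst t ht)⟩
  refine (Submodule.mem_iInf _).2 fun i => mem_ker_toLpLin_iff.2 ?_
  rw [WithLp.ofLp_sub, Matrix.mulVec_sub, (hsol w).1 hw, hmem T₂ le_rfl, sub_self]
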